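/- Let $X$ and $Y$ be real Banach spaces with $\dim X>1$ and $\dim Y>1$, where $X$ is reflexive and strictly convex and $Y$ is strictly convex. Let $B(X,Y)$ be the space of bounded linear operators from $X$ to $Y$ with the operator norm, and $K(X,Y)\subseteq B(X,Y)$ the subspace of compact operators. For elements $x,y$ of a real normed space $E$ write $x\perp_B y$ if $\|x+\lambda y\|\ge\|x\|$ for all $\lambda\in\mathbb{R}$. An element $x\in E$ is called right symmetric in $E$ if, for every $y\in E$, $y\perp_B x$ implies $x\perp_B y$; a nonzero $x\in E$ is called smooth in $E$ if there is exactly one $f\in E^*$ with $\|f\|=1$ and $f(x)=\|x\|$. Let $T\in K(X,Y)$ be smooth in $K(X,Y)$ or in $B(X,Y)$. Then $T$ is right symmetric neither in $K(X,Y)$ nor in $B(X,Y)$. -/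

import Mathlib

/-- Birkhoff-James orthogonality `x ⊥_B y` in a real normed space. -/
def BirkhoffOrth {E : Type*} [NormedAddCommGroup E] [NormedSpace ℝ E] (x y : E) : Prop :=
  ∀ c : ℝ, ‖x‖ ≤ ‖x + c • y‖

/-- `x` is right symmetric in `E`: `y ⊥_B x` implies `x ⊥_B y` for every `y` in `E`. -/
def IsRightSymmetric {E : Type*} [NormedAddCommGroup E] [NormedSpace ℝ E] (x : E) : Prop :=
  ∀ y : E, BirkhoffOrth y x → BirkhoffOrth x y

/-- `x` is a smooth point of `E`: it is nonzero and has exactly one norming functional, that is,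
exactly one continuous linear functional `f` on `E` with `‖f‖ = 1` and `f x = ‖x‖`. -/
def IsSmoothPoint {E : Type*} [NormedAddCommGroup E] [NormedSpace ℝ E] (x : E) : Prop :=
  x ≠ 0 ∧ ∃! f : StrongDual ℝ E, ‖f‖ = 1 ∧ f x = ‖x‖

/-- A real normed space is reflexive if its canonical embedding into the bidual is onto. -/
def IsReflexiveSpace (E : Type*) [NormedAddCommGroup E] [NormedSpace ℝ E] : Prop :=
  Function.Surjective (NormedSpace.inclusionInDoubleDual ℝ E)

/-- `K(X, Y)`: the compact operators, as a subspace of the bounded linear operators `X →L[ℝ] Y`;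
it carries the operator norm. -/
abbrev CompactOps (X Y : Type*) [NormedAddCommGroup X] [NormedSpace ℝ X]
    [NormedAddCommGroup Y] [NormedSpace ℝ Y] : Submodule ℝ (X →L[ℝ] Y) :=
  compactOperator (RingHom.id ℝ) X Y

open Metric Set

/-! It suffices to argue in `CompactOps X Y`: smoothness and right symmetry in the full operator
space both pass to this subspace. Suppose `A` is smooth and right symmetric there, attains its norm
at `x₀`, and `g` norms `A x₀`. The norming functional of `A` is then `S ↦ g (S x₀)`, and for every
compact `S` in its kernel, `‖S + t • A‖` is minimal only at `t = 0`
(`IsSmoothPoint.norm_lt_norm_add_smul`).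

Two test operators contradict this. If `f` is a unit functional killing `x₀` with norming point
`x₁`, then `f ⊗ (-A x₁)` forces `A x₁ = 0`; hence `ker A + span x₀` is everything and `A = φ ⊗ A x₀`
has rank one. For rank one, `exists_norm_smulRight_add_le` gives a compact operator in the kernel
for which some `t ≠ 0` does no worse than `t = 0`. -/

section

variable {E X Y Z : Type*} [NormedAddCommGroup E] [NormedSpace ℝ E]
  [NormedAddCommGroup X] [NormedSpace ℝ X] [NormedAddCommGroup Y] [NormedSpace ℝ Y]
  [NormedAddCommGroup Z] [NormedSpace ℝ Z]

/-! ### Hahn-Banach functionals and James' criterion. -/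

/-- A functional vanishing on a closed subspace `p` whose value at `x` is the distance from `x`
to `p`. -/
theorem Submodule.exists_dual_eq_norm_mk (p : Submodule ℝ E) (hp : IsClosed (p : Set E)) (x : E) :
    ∃ f : StrongDual ℝ E, ‖f‖ ≤ 1 ∧ (∀ m ∈ p, f m = 0) ∧ f x = ‖(Submodule.Quotient.mk x : E ⧸ p)‖ := by
  have : IsClosed (p : Set E) := hp
  obtain ⟨G, hG, hGx⟩ := exists_dual_vector'' ℝ (Submodule.Quotient.mk x : E ⧸ p)
  have hb : ∀ v : E, ‖((G : (E ⧸ p) →ₗ[ℝ] ℝ) ∘ₗ p.mkQ) v‖ ≤ 1 * ‖v‖ := fun v =>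
    calc ‖G (Submodule.Quotient.mk v : E ⧸ p)‖ ≤ 1 * ‖(Submodule.Quotient.mk v : E ⧸ p)‖ :=
          G.le_of_opNorm_le hG _
      _ ≤ 1 * ‖v‖ := by gcongr; exact Submodule.Quotient.norm_mk_le p v
  refine ⟨LinearMap.mkContinuous _ 1 hb, LinearMap.mkContinuous_norm_le _ zero_le_one _, ?_, ?_⟩
  · intro m hm
    have : (Submodule.Quotient.mk m : E ⧸ p) = 0 := (Submodule.Quotient.mk_eq_zero p).2 hm
    simp [this]
  · simpa using hGx

/-- A proper closed subspace is annihilated by a functional of norm one. -/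
theorem Submodule.exists_norm_one_dual_eq_zero (p : Submodule ℝ E) (hp : IsClosed (p : Set E))
    (hne : p ≠ ⊤) : ∃ f : StrongDual ℝ E, ‖f‖ = 1 ∧ ∀ m ∈ p, f m = 0 := by
  have : IsClosed (p : Set E) := hp
  obtain ⟨x, hx⟩ : ∃ x, x ∉ p := by
    by_contra! h
    exact hne (eq_top_iff.2 fun x _ => h x)
  obtain ⟨f, -, hf0, hfx⟩ := p.exists_dual_eq_norm_mk hp x
  have hf : f ≠ 0 := by
    rintro rfl
    have h0 : (Submodule.Quotient.mk x : E ⧸ p) = 0 := norm_eq_zero.1 (by simpa using hfx.symm)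
    exact hx ((Submodule.Quotient.mk_eq_zero p).1 h0)
  refine ⟨‖f‖⁻¹ • f, ?_, ?_⟩
  · rw [norm_smul, norm_inv, norm_norm, inv_mul_cancel₀ (norm_ne_zero_iff.2 hf)]
  · intro m hm
    simp [hf0 m hm]

/-- James' characterization of Birkhoff-James orthogonality. -/
theorem BirkhoffOrth.exists_dual {x y : E} (h : BirkhoffOrth x y) (hx : x ≠ 0) :
    ∃ f : StrongDual ℝ E, ‖f‖ = 1 ∧ f x = ‖x‖ ∧ f y = 0 := by
  have hcl : IsClosed ((Submodule.span ℝ {y} : Submodule ℝ E) : Set E) :=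
    Submodule.closed_of_finiteDimensional _
  obtain ⟨f, hf1, hf0, hfx⟩ := (Submodule.span ℝ {y}).exists_dual_eq_norm_mk hcl x
  have hle : ‖x‖ ≤ f x := by
    rw [hfx]
    refine le_of_forall_pos_le_add fun ε hε => ?_
    obtain ⟨m, hm, hlt⟩ := Submodule.Quotient.norm_mk_lt
      (Submodule.Quotient.mk x : E ⧸ Submodule.span ℝ {y}) hε
    obtain ⟨c, hc⟩ := Submodule.mem_span_singleton.1 ((Submodule.Quotient.eq _).1 hm)
    have := h c
    rw [hc, add_sub_cancel] at this
    linarith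
  have hpos : 0 < ‖x‖ := norm_pos_iff.2 hx
  have hfle : f x ≤ ‖f‖ * ‖x‖ := (le_abs_self _).trans (f.le_opNorm x)
  refine ⟨f, le_antisymm hf1 ?_, le_antisymm ?_ hle, hf0 y (Submodule.mem_span_singleton_self y)⟩
  · by_contra! hlt
    nlinarith
  · nlinarith

/-! ### Norm attainment on reflexive spaces. -/

/-- A bounded operator on a reflexive space maps the closed unit ball to a closed set. -/
theorem IsReflexiveSpace.isClosed_image_closedBall (hX : IsReflexiveSpace X) (R : X →L[ℝ] Z) :
    IsClosed (R '' closedBall 0 1) := by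
  refine isClosed_of_closure_subset fun z hz => ?_
  let e : Z → (StrongDual ℝ Z → ℝ) := fun z h => h z
  have he : Continuous e := continuous_pi fun h => h.continuous
  -- By Banach-Alaoglu the bidual ball has compact image under `Ψ`; this image contains that of the
  -- unit ball of `X`, and reflexivity brings its points back to `X`.
  let Ψ : WeakDual ℝ (StrongDual ℝ X) → (StrongDual ℝ Z → ℝ) := fun F h => F (h.comp R)
  have hΨ : Continuous Ψ := continuous_pi fun h => WeakDual.eval_continuous _
  have hA := ((WeakDual.isCompact_closedBall (𝕜 := ℝ)
    (0 : StrongDual ℝ (StrongDual ℝ X)) 1).image hΨ).isClosed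
  have hmem : e z ∈ Ψ '' (WeakDual.toStrongDual ⁻¹' closedBall 0 1) := by
    have h1 : e z ∈ closure (e '' (R '' closedBall 0 1)) :=
      image_closure_subset_closure_image he ⟨z, hz, rfl⟩
    refine closure_minimal ?_ hA h1
    rintro _ ⟨_, ⟨x, hx, rfl⟩, rfl⟩
    refine ⟨StrongDual.toWeakDual (NormedSpace.inclusionInDoubleDual ℝ X x), ?_, rfl⟩
    have hx' : ‖x‖ ≤ 1 := by simpa using hx
    have : ‖NormedSpace.inclusionInDoubleDual ℝ X x‖ ≤ 1 :=
      (NormedSpace.double_dual_bound ℝ X x).trans hx'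
    simpa using this
  obtain ⟨F, hF, hFz⟩ := hmem
  obtain ⟨x, hx⟩ := hX (WeakDual.toStrongDual F)
  refine ⟨x, ?_, ?_⟩
  · have h2 : ‖NormedSpace.inclusionInDoubleDual ℝ X x‖ ≤ 1 := by 
      rw [hx]
      exact (mem_closedBall_zero_iff (E := StrongDual ℝ (StrongDual ℝ X))).1 hF
    have h3 : ‖NormedSpace.inclusionInDoubleDualLi ℝ (E := X) x‖ ≤ 1 := h2
    rw [LinearIsometry.norm_map] at h3
    simpa using h3
  · refine (SeparatingDual.eq_iff_forall_dual_eq (R := ℝ)).2 fun h => ?_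
    calc h (R x) = NormedSpace.inclusionInDoubleDual ℝ X x (h.comp R) := rfl
      _ = h z := by rw [hx]; exact congrFun hFz h

theorem IsReflexiveSpace.isCompact_image_closedBall (hX : IsReflexiveSpace X) {R : X →L[ℝ] Z}
    (hR : IsCompactOperator R) : IsCompact (R '' closedBall 0 1) := by
  have := hR.isCompact_closure_image_closedBall (f := (R : X →ₗ[ℝ] Z)) 1
  rwa [ContinuousLinearMap.coe_coe, (hX.isClosed_image_closedBall R).closure_eq] at this

theorem IsReflexiveSpace.exists_norm_map_eq (hX : IsReflexiveSpace X) {R : X →L[ℝ] Z}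
    (hR : IsCompactOperator R) : ∃ x, ‖x‖ ≤ 1 ∧ ‖R x‖ = ‖R‖ := by
  obtain ⟨_, ⟨x, hx, rfl⟩, hmax⟩ := (hX.isCompact_image_closedBall hR).exists_isMaxOn
    ⟨R 0, 0, by simp, rfl⟩ continuous_norm.continuousOn
  have hx1 : ‖x‖ ≤ 1 := by simpa using hx
  refine ⟨x, hx1, le_antisymm (R.unit_le_opNorm x hx1) ?_⟩
  refine R.opNorm_le_of_unit_norm (norm_nonneg _) fun z hz => ?_
  exact hmax ⟨z, by simp [hz], rfl⟩

theorem ContinuousLinearMap.isCompactOperator_smulRight (f : StrongDual ℝ X) (y : Y) :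
    IsCompactOperator (f.smulRight y) := by
  have h : IsCompactOperator (id : ℝ → ℝ) := isCompactOperator_id
  exact (h.comp_clm f).clm_comp (ContinuousLinearMap.toSpanSingleton ℝ y)

theorem IsReflexiveSpace.exists_dual_apply_eq_norm (hX : IsReflexiveSpace X)
    (f : StrongDual ℝ X) : ∃ x, ‖x‖ ≤ 1 ∧ f x = ‖f‖ := by
  have h : IsCompactOperator (id : ℝ → ℝ) := isCompactOperator_id
  obtain ⟨x, hx, hfx⟩ := hX.exists_norm_map_eq (R := f) (h.comp_clm f)
  rcases abs_choice (f x) with h | h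
  · exact ⟨x, hx, by rw [← h]; exact hfx⟩
  · exact ⟨-x, by simpa, by rw [map_neg, ← h]; exact hfx⟩

theorem eq_of_dual_apply_eq_one [StrictConvexSpace ℝ X] {f : StrongDual ℝ X} (hf : ‖f‖ ≤ 1)
    {x z : X} (hx : ‖x‖ ≤ 1) (hz : ‖z‖ ≤ 1) (hfx : f x = 1) (hfz : f z = 1) : x = z := by
  have key : ∀ v, f v ≤ ‖v‖ := fun v =>
    (le_abs_self _).trans ((f.le_of_opNorm_le hf v).trans_eq (one_mul _))
  have h1 := key x
  have h2 := key z
  have h3 := key (x + z)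
  rw [map_add] at h3
  have h4 := norm_add_le x z
  exact eq_of_norm_eq_of_norm_add_eq (by linarith) (by linarith)

/-! ### Strict orthogonality from smoothness and right symmetry. -/

theorem exists_birkhoffOrth_add_smul {x : E} (hx : x ≠ 0) (y : E) :
    ∃ s : ℝ, BirkhoffOrth (y + s • x) x := by
  have hc : Continuous fun s : ℝ => ‖y + s • x‖ := by fun_prop
  have hlim : Filter.Tendsto (fun s : ℝ => ‖y + s • x‖) (Filter.cocompact ℝ) Filter.atTop := by
    have h1 : Filter.Tendsto (fun s : ℝ => ‖s‖ * ‖x‖ + -‖y‖) (Filter.cocompact ℝ) Filter.atTop :=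
      Filter.tendsto_atTop_add_const_right _ _
        ((tendsto_norm_cocompact_atTop).atTop_mul_const (norm_pos_iff.2 hx))
    refine Filter.tendsto_atTop_mono (fun s => ?_) h1
    have := norm_sub_le (y + s • x) y
    rw [add_sub_cancel_left, norm_smul] at this
    linarith
  obtain ⟨s, hs⟩ := hc.exists_forall_le hlim
  refine ⟨s, fun c => (hs (s + c)).trans_eq ?_⟩
  rw [add_smul, add_assoc]

/-- At a smooth right symmetric point `x` the kernel of the norming functional is strictly
Birkhoff-James orthogonal to `x`. -/
theorem IsSmoothPoint.norm_lt_norm_add_smul {x : E} (hx : IsSmoothPoint x)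
    (hsym : IsRightSymmetric x) {F : StrongDual ℝ E} (hF : ‖F‖ = 1) (hFx : F x = ‖x‖) {y : E}
    (hy : F y = 0) {t : ℝ} (ht : t ≠ 0) : ‖y‖ < ‖y + t • x‖ := by
  obtain ⟨hx0, hu⟩ := hx
  have hn : ‖x‖ ≠ 0 := norm_ne_zero_iff.2 hx0
  have key : ∀ s : ℝ, BirkhoffOrth (y + s • x) x → s = 0 := by
    intro s hs
    obtain ⟨G, hG, hGx, hGy⟩ := (hsym _ hs).exists_dual hx0
    obtain rfl : G = F := hu.unique ⟨hG, hGx⟩ ⟨hF, hFx⟩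
    simpa [hy, hFx, hn] using hGy
  obtain ⟨s, hs⟩ := exists_birkhoffOrth_add_smul hx0 y
  obtain rfl := key s hs
  rw [zero_smul, add_zero] at hs
  -- Equality would make `t` a second minimiser, which `key` excludes.
  refine (hs t).lt_of_ne fun heq => ht (key t fun c => ?_)
  rw [← heq, add_assoc, ← add_smul]
  exact hs _

theorem IsSmoothPoint.norm_coe_lt_norm_add_smul {p : Submodule ℝ E} {x : p} (hx : IsSmoothPoint x)
    (hsym : IsRightSymmetric x) {F : StrongDual ℝ E} (hF : ‖F‖ ≤ 1) (hFx : F x = ‖(x : E)‖) {y : E}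
    (hyp : y ∈ p) (hy : F y = 0) {t : ℝ} (ht : t ≠ 0) : ‖y‖ < ‖y + t • (x : E)‖ := by
  let G : StrongDual ℝ p := F.comp p.subtypeL
  have hGx : G x = ‖x‖ := hFx
  have hG1 : ‖G‖ ≤ 1 := G.opNorm_le_bound zero_le_one fun v => F.le_of_opNorm_le hF v
  have hG2 : 1 ≤ ‖G‖ := by
    have h1 := (le_abs_self _).trans (G.le_opNorm x)
    rw [hGx] at h1
    exact le_of_mul_le_mul_right (by rwa [one_mul]) (norm_pos_iff.2 hx.1)
  exact hx.norm_lt_norm_add_smul hsym (le_antisymm hG1 hG2) hGx (y := ⟨y, hyp⟩) hy ht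

/-! ### Norming points of functionals that kill `x₀`. -/

/-- The image of the ball under `(f, T)` is compact, so `f` attains its maximum over the points with
`T x` far from `T x₁`. By strict convexity only `x₁` has `f = 1`, so this maximum is below `1`. -/
theorem IsReflexiveSpace.exists_norm_map_sub_lt [StrictConvexSpace ℝ X] (hX : IsReflexiveSpace X)
    {T : X →L[ℝ] Y} (hT : IsCompactOperator T) {f : StrongDual ℝ X} (hf : ‖f‖ ≤ 1) {x₁ : X}
    (hx₁ : ‖x₁‖ ≤ 1) (hfx₁ : f x₁ = 1) {ε : ℝ} (hε : 0 < ε) :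
    ∃ δ > 0, ∀ x, ‖x‖ ≤ 1 → 1 - δ < f x → ‖T x - T x₁‖ < ε := by
  have hR : IsCompactOperator (f.prod T) := by
    have h1 := f.isCompactOperator_smulRight ((1 : ℝ), (0 : Y))
    have h2 := hT.clm_comp (ContinuousLinearMap.inr ℝ ℝ Y)
    have h3 := h1.add h2
    have h4 : ⇑(f.prod T) = ⇑(f.smulRight ((1 : ℝ), (0 : Y))) +
        ⇑(ContinuousLinearMap.inr ℝ ℝ Y) ∘ ⇑T := by
      funext x
      ext <;> simp
    rw [h4]
    exact h3
  have hK := hX.isCompact_image_closedBall hR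
  have hcl : IsClosed {p : ℝ × Y | ε ≤ ‖p.2 - T x₁‖} :=
    isClosed_le continuous_const (by fun_prop)
  have hK' := hK.inter_right hcl
  rcases (f.prod T '' closedBall 0 1 ∩ {p : ℝ × Y | ε ≤ ‖p.2 - T x₁‖}).eq_empty_or_nonempty
    with he | hne
  · refine ⟨1, one_pos, fun x hx _ => ?_⟩
    by_contra! hlt
    have : (f.prod T) x ∈ (∅ : Set (ℝ × Y)) := he ▸ ⟨⟨x, by simpa using hx, rfl⟩, hlt⟩
    exact this
  · obtain ⟨_, ⟨⟨z, hz, rfl⟩, hzε⟩, hmax⟩ := hK'.exists_isMaxOn hne continuous_fst.continuousOn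
    have hz1 : ‖z‖ ≤ 1 := by simpa using hz
    have hfz : f z ≤ 1 := (le_abs_self _).trans <|
      (f.unit_le_opNorm z hz1).trans hf
    have hfz' : f z ≠ 1 := by
      intro h
      obtain rfl := eq_of_dual_apply_eq_one hf hz1 hx₁ h hfx₁
      have : ε ≤ 0 := by simpa using hzε
      linarith
    refine ⟨1 - f z, sub_pos.2 (hfz.lt_of_ne hfz'), fun x hx hlt => ?_⟩
    by_contra! hle
    have : f x ≤ f z := hmax ⟨⟨x, by simpa using hx, rfl⟩, hle⟩
    linarith

/-- Were `T x₁ ≠ 0`, adding a small `t • T` to `f ⊗ (-T x₁)` would not increase the norm: near the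
maximum of `f` the two terms partly cancel, and elsewhere `|f| ≤ 1 - δ` leaves room. -/
theorem IsReflexiveSpace.map_eq_zero_of_norm_lt_norm_add_smul [StrictConvexSpace ℝ X]
    (hX : IsReflexiveSpace X) {T : X →L[ℝ] Y} (hT : IsCompactOperator T) {x₀ : X}
    (hcore : ∀ S : X →L[ℝ] Y, IsCompactOperator S → S x₀ = 0 → ∀ t : ℝ, t ≠ 0 → ‖S‖ < ‖S + t • T‖)
    {f : StrongDual ℝ X} (hf : ‖f‖ ≤ 1) (hfx₀ : f x₀ = 0) {x₁ : X}
    (hx₁ : ‖x₁‖ ≤ 1) (hfx₁ : f x₁ = 1) : T x₁ = 0 := by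
  by_contra hne
  have hn : 0 < ‖T x₁‖ := norm_pos_iff.2 hne
  obtain ⟨δ', hδ', hδ'T⟩ := hX.exists_norm_map_sub_lt hT hf hx₁ hfx₁ hn
  obtain ⟨δ, hδ, hδ2, hδT⟩ : ∃ δ > 0, δ ≤ 1 / 2 ∧
      ∀ x, ‖x‖ ≤ 1 → 1 - δ < f x → ‖T x - T x₁‖ < ‖T x₁‖ :=
    ⟨min δ' (1 / 2), lt_min hδ' (by norm_num), min_le_right _ _, fun x hx h =>
      hδ'T x hx (by linarith [min_le_left δ' (1 / 2)])⟩
  -- `t ≤ 1 / 2 ≤ 1 - δ` keeps `f x - t` nonnegative on the slice; the last bound lets the gap `δ *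
  -- ‖T x₁‖` absorb `t • T` off it.
  obtain ⟨t, ht, ht2, htT⟩ : ∃ t > 0, t ≤ 1 / 2 ∧ t * ‖T‖ ≤ δ * ‖T x₁‖ := by
    have hp : 0 < ‖T‖ + 1 := by positivity
    refine ⟨min (1 / 2) (δ * ‖T x₁‖ / (‖T‖ + 1)), by positivity, min_le_left _ _, ?_⟩
    calc min (1 / 2) (δ * ‖T x₁‖ / (‖T‖ + 1)) * ‖T‖
        ≤ δ * ‖T x₁‖ / (‖T‖ + 1) * (‖T‖ + 1) := by
          gcongr
          · exact min_le_right _ _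
          · linarith
      _ = δ * ‖T x₁‖ := by field_simp
  let S : X →L[ℝ] Y := f.smulRight (-T x₁)
  have hS : ‖T x₁‖ ≤ ‖S‖ := by
    have := S.unit_le_opNorm x₁ hx₁
    simpa [S, hfx₁] using this
  have key : ∀ x, ‖x‖ ≤ 1 → 1 - δ < f x → ‖(S + t • T) x‖ ≤ ‖T x₁‖ := by
    intro x hx hlt
    have h1 : (S + t • T) x = t • (T x - T x₁) - (f x - t) • T x₁ := by
      simp only [S, add_apply, ContinuousLinearMap.smulRight_apply,
        smul_apply]
      module
    have hfx : f x ≤ 1 := (le_abs_self _).trans <| (f.unit_le_opNorm x hx).trans hf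
    rw [h1]
    refine (norm_sub_le _ _).trans ?_
    rw [norm_smul, norm_smul, Real.norm_of_nonneg ht.le,
      Real.norm_of_nonneg (by linarith : 0 ≤ f x - t)]
    nlinarith [(hδT x hx hlt)]
  have hle : ‖S + t • T‖ ≤ ‖T x₁‖ := by
    refine ContinuousLinearMap.opNorm_le_of_unit_norm hn.le fun x hx => ?_
    rcases lt_or_ge (1 - δ) (f x) with h | h
    · exact key x hx.le h
    rcases lt_or_ge (1 - δ) (f (-x)) with h' | h'
    · simpa only [map_neg, norm_neg] using key (-x) (by simp [hx]) h'
    rw [map_neg] at h'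
    have habs : ‖f x‖ ≤ 1 - δ := abs_le.2 ⟨by linarith, h⟩
    have hTx : ‖T x‖ ≤ ‖T‖ := T.unit_le_opNorm x hx.le
    calc ‖(S + t • T) x‖ ≤ ‖f x • (-T x₁)‖ + ‖t • T x‖ := norm_add_le _ _
      _ = ‖f x‖ * ‖T x₁‖ + t * ‖T x‖ := by
        rw [norm_smul, norm_smul, norm_neg, Real.norm_of_nonneg ht.le]
      _ ≤ (1 - δ) * ‖T x₁‖ + t * ‖T‖ := by gcongr
      _ ≤ ‖T x₁‖ := by linarith
  have := hcore S (f.isCompactOperator_smulRight _) (by simp [S, hfx₀]) t ht.ne'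
  linarith

/-! ### The rank one case. -/

/-- If `y` is Birkhoff-James orthogonal to `w`, then some rank two perturbation of
`(φ - f) ⊗ y` is not strictly Birkhoff-James orthogonal to `φ ⊗ w`. -/
theorem exists_norm_smulRight_add_le {φ f : StrongDual ℝ X} (hφ : ‖φ‖ ≤ 1) (hf : ‖f‖ ≤ 1)
    (hφf : 1 < ‖φ - f‖) {y w : Y} (hy : ‖y‖ = 1) (hyw : BirkhoffOrth y w) :
    ∃ a t : ℝ, t ≠ 0 ∧ ‖(φ - f).smulRight y + a • f.smulRight w + t • φ.smulRight w‖ ≤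
      ‖(φ - f).smulRight y + a • f.smulRight w‖ := by
  have horth : ∀ α β : ℝ, |β| ≤ ‖β • y + α • w‖ := by
    intro α β
    rcases eq_or_ne β 0 with rfl | hβ
    · simp
    have h1 : β • y + α • w = β • (y + (α / β) • w) := by
      rw [smul_add, smul_smul, mul_div_cancel₀ _ hβ]
    have h2 := hyw (α / β)
    rw [h1, norm_smul, Real.norm_eq_abs]
    rw [hy] at h2
    nlinarith [abs_nonneg β]
  obtain ⟨η, hη, hηψ⟩ : ∃ η > 0, 1 + 2 * η = ‖φ - f‖ :=
    ⟨(‖φ - f‖ - 1) / 2, by linarith, by ring⟩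
  obtain ⟨a, ha, haw⟩ : ∃ a > 0, 2 * a * ‖w‖ ≤ η := by
    refine ⟨η / (2 * (‖w‖ + 1)), by positivity, ?_⟩
    rw [show 2 * (η / (2 * (‖w‖ + 1))) * ‖w‖ = η * (‖w‖ / (‖w‖ + 1)) by field_simp]
    exact mul_le_of_le_one_right hη.le ((div_le_one (by positivity)).2 (by linarith))
  -- Where `φ x - f x ≥ 1 + η`, one has `f x ≤ -η`, so `t ≤ a * η` keeps the perturbed coefficient
  -- of `w` between `a * f x` and `0`. Elsewhere `t ≤ a` bounds it by `2 * a`, which costs at most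
  -- `η`.
  obtain ⟨t, ht, hta, htη⟩ : ∃ t > 0, t ≤ a ∧ t ≤ a * η :=
    ⟨min a (a * η), by positivity, min_le_left _ _, min_le_right _ _⟩
  refine ⟨a, t, ht.ne', ?_⟩
  set S := (φ - f).smulRight y + a • f.smulRight w with hSdef
  have hSx : ∀ x, S x = (φ x - f x) • y + (a * f x) • w := fun x => by
    simp [hSdef, smul_smul]
  have hSTx : ∀ x, (S + t • φ.smulRight w) x = (φ x - f x) • y + (a * f x + t * φ x) • w :=
    fun x => by
      rw [add_apply, hSx]
      simp only [smul_apply, ContinuousLinearMap.smulRight_apply]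
      module
  have hψS : ‖φ - f‖ ≤ ‖S‖ := by
    refine ContinuousLinearMap.opNorm_le_bound _ (norm_nonneg _) fun x => ?_
    refine le_trans ?_ (S.le_opNorm x)
    rw [hSx]
    exact horth _ _
  have hbφ : ∀ x, ‖x‖ ≤ 1 → |φ x| ≤ 1 := fun x hx => (φ.unit_le_opNorm x hx).trans hφ
  have hbf : ∀ x, ‖x‖ ≤ 1 → |f x| ≤ 1 := fun x hx => (f.unit_le_opNorm x hx).trans hf
  have key : ∀ x, ‖x‖ ≤ 1 → 1 + η ≤ φ x - f x → ‖(S + t • φ.smulRight w) x‖ ≤ ‖S‖ := by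
    intro x hx hge
    obtain ⟨hp1, hp2⟩ := abs_le.1 (hbφ x hx)
    obtain ⟨hq1, hq2⟩ := abs_le.1 (hbf x hx)
    have hq : f x < 0 := by linarith
    have hp : 0 < φ x := by linarith
    have haq : a * f x < 0 := mul_neg_of_pos_of_neg ha hq
    have hsum : a * f x + t * φ x ≤ 0 := by nlinarith
    set θ := (a * f x + t * φ x) / (a * f x) with hθ
    have hθ0 : 0 ≤ θ := div_nonneg_of_nonpos hsum haq.le
    have hθ1 : θ ≤ 1 := (div_le_one_of_neg haq).2 (by nlinarith)
    have hθm : a * f x + t * φ x = θ * (a * f x) := by rw [hθ, div_mul_cancel₀ _ haq.ne]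
    -- Orthogonality of `y` to `w` makes the second point of this convex combination no longer than
    -- `S x`.
    have hcomb : (φ x - f x) • y + (a * f x + t * φ x) • w =
        θ • S x + (1 - θ) • ((φ x - f x) • y) := by
      rw [hθm, hSx]
      module
    have h1 : ‖(φ x - f x) • y‖ ≤ ‖S x‖ := by
      rw [norm_smul, hy, mul_one, hSx]
      exact horth _ _
    rw [hSTx, hcomb]
    refine le_trans (norm_add_le _ _) (le_trans ?_ (S.unit_le_opNorm x hx))
    rw [norm_smul, norm_smul, Real.norm_of_nonneg hθ0, Real.norm_of_nonneg (sub_nonneg.2 hθ1)]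
    nlinarith
  refine ContinuousLinearMap.opNorm_le_of_unit_norm (norm_nonneg _) fun x hx => ?_
  rcases le_or_gt (1 + η) (φ x - f x) with h | h
  · exact key x hx.le h
  rcases le_or_gt (1 + η) (φ (-x) - f (-x)) with h' | h'
  · simpa only [map_neg, norm_neg] using key (-x) (by simp [hx]) h'
  rw [map_neg, map_neg] at h'
  have hab : |φ x - f x| ≤ 1 + η := abs_le.2 ⟨by linarith, h.le⟩
  have hcoef : |a * f x + t * φ x| ≤ 2 * a := by
    refine (abs_add_le _ _).trans ?_
    rw [abs_mul, abs_mul, abs_of_pos ha, abs_of_pos ht]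
    nlinarith [hbφ x hx.le, hbf x hx.le]
  rw [hSTx]
  refine (norm_add_le _ _).trans ?_
  rw [norm_smul, norm_smul, hy, mul_one, Real.norm_eq_abs, Real.norm_eq_abs]
  nlinarith [mul_le_mul_of_nonneg_right hcoef (norm_nonneg w)]

theorem exists_norm_eq_one_dual_apply_eq_zero (hY : 1 < Module.rank ℝ Y) (g : StrongDual ℝ Y) :
    ∃ y, ‖y‖ = 1 ∧ g y = 0 := by
  obtain ⟨y, hy, hgy⟩ : ∃ y, y ≠ 0 ∧ g y = 0 := by
    by_contra! h
    have hinj : Function.Injective (g : Y →ₗ[ℝ] ℝ) := by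
      refine (injective_iff_map_eq_zero _).2 fun y hy => ?_
      by_contra hne
      exact h y hne hy
    have := LinearMap.lift_rank_le_of_injective _ hinj
    rw [Module.rank_self, Cardinal.lift_one, Cardinal.lift_le_one_iff] at this
    exact absurd hY this.not_gt
  refine ⟨‖y‖⁻¹ • y, ?_, by simp [hgy]⟩
  rw [norm_smul, norm_inv, norm_norm, inv_mul_cancel₀ (norm_ne_zero_iff.2 hy)]

theorem span_singleton_ne_top_of_one_lt_rank (hX : 1 < Module.rank ℝ X) (x : X) :
    Submodule.span ℝ {x} ≠ ⊤ := by
  intro h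
  have h1 : Module.rank ℝ (Submodule.span ℝ {x}) ≤ Cardinal.mk ({x} : Set X) := rank_span_le _
  rw [h, rank_top, Cardinal.mk_singleton] at h1
  exact absurd hX h1.not_gt

/-! ### Passage to subspaces and the contradiction. -/

/-- Smoothness in the ambient space passes to a subspace. -/
theorem IsSmoothPoint.of_coe {p : Submodule ℝ E} {x : p} (hx : IsSmoothPoint (x : E)) :
    IsSmoothPoint x := by
  obtain ⟨hx0, hu⟩ := hx
  have hx0' : x ≠ 0 := fun h => hx0 (by simp [h])
  obtain ⟨F, hF, hFx⟩ := exists_dual_vector ℝ x (norm_ne_zero_iff.2 hx0')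
  refine ⟨hx0', F, ⟨hF, hFx⟩, ?_⟩
  rintro G ⟨hG, hGx⟩
  obtain ⟨F', hF', hF'n⟩ := exists_extension_norm_eq p F
  obtain ⟨G', hG', hG'n⟩ := exists_extension_norm_eq p G
  have : G' = F' := hu.unique ⟨hG'n.trans hG, (hG' x).trans hGx⟩ ⟨hF'n.trans hF, (hF' x).trans hFx⟩
  ext z
  rw [← hG', ← hF', this]

theorem IsRightSymmetric.of_coe {p : Submodule ℝ E} {x : p} (hx : IsRightSymmetric (x : E)) :
    IsRightSymmetric x :=
  fun y hy => hx y hy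

theorem IsSmoothPoint.not_isRightSymmetric_compactOps [StrictConvexSpace ℝ X]
    (hX : 1 < Module.rank ℝ X) (hY : 1 < Module.rank ℝ Y) (hrefl : IsReflexiveSpace X)
    {T : CompactOps X Y} (hT : IsSmoothPoint T) : ¬ IsRightSymmetric T := by
  intro hsym
  obtain ⟨A, hA⟩ := T
  replace hA : IsCompactOperator A := hA
  have hA0 : A ≠ 0 := fun h => hT.1 (Subtype.ext h)
  have hAn : ‖A‖ ≠ 0 := norm_ne_zero_iff.2 hA0
  obtain ⟨x₀, hx₀, hAx₀⟩ := hrefl.exists_norm_map_eq hA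
  obtain ⟨g, hg, hgx₀⟩ := exists_dual_vector ℝ (A x₀) (by rwa [hAx₀])
  replace hgx₀ : g (A x₀) = ‖A‖ := hgx₀.trans hAx₀
  have hcore : ∀ S : X →L[ℝ] Y, IsCompactOperator S → g (S x₀) = 0 →
      ∀ t : ℝ, t ≠ 0 → ‖S‖ < ‖S + t • A‖ := by
    intro S hS hgS t ht
    let F : StrongDual ℝ (X →L[ℝ] Y) := g.comp (ContinuousLinearMap.apply ℝ Y x₀)
    have hF : ‖F‖ ≤ 1 := by
      refine F.opNorm_le_bound zero_le_one fun R => ?_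
      calc ‖g (R x₀)‖ ≤ 1 * ‖R x₀‖ := g.le_of_opNorm_le hg.le _
        _ ≤ 1 * ‖R‖ := by gcongr; exact R.unit_le_opNorm _ hx₀
    exact hT.norm_coe_lt_norm_add_smul hsym hF hgx₀ hS hgS ht
  have hvanish : ∀ f : StrongDual ℝ X, ‖f‖ = 1 → f x₀ = 0 →
      ∃ x₁, ‖x₁‖ ≤ 1 ∧ f x₁ = 1 ∧ A x₁ = 0 := by
    intro f hf hfx₀
    obtain ⟨x₁, hx₁, hfx₁⟩ := hrefl.exists_dual_apply_eq_norm f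
    rw [hf] at hfx₁
    exact ⟨x₁, hx₁, hfx₁, hrefl.map_eq_zero_of_norm_lt_norm_add_smul hA
      (fun S hS h => hcore S hS (by rw [h, map_zero])) hf.le hfx₀ hx₁ hfx₁⟩
  have htop : A.ker ⊔ Submodule.span ℝ {x₀} = ⊤ := by
    by_contra hne
    obtain ⟨f, hf, hf0⟩ := Submodule.exists_norm_one_dual_eq_zero _
      (Submodule.isClosed_sup_finiteDimensional _ _ A.isClosed_ker) hne
    obtain ⟨x₁, -, hfx₁, hAx₁⟩ := hvanish f hf
      (hf0 _ (Submodule.mem_sup_right (Submodule.mem_span_singleton_self x₀)))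
    have := hf0 x₁ (Submodule.mem_sup_left hAx₁)
    linarith
  let φ : StrongDual ℝ X := ‖A‖⁻¹ • g.comp A
  have hφv : ∀ x, φ x = ‖A‖⁻¹ * g (A x) := fun x => rfl
  have hφx₀ : φ x₀ = 1 := by rw [hφv, hgx₀, inv_mul_cancel₀ hAn]
  have hφ : ‖φ‖ ≤ 1 := by
    have h1 : ‖g.comp A‖ ≤ ‖A‖ := (g.opNorm_comp_le A).trans (by rw [hg, one_mul])
    rw [norm_smul, norm_inv, norm_norm]
    exact inv_mul_le_one_of_le₀ h1 (norm_nonneg _)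
  have hAφ : A = φ.smulRight (A x₀) := by
    ext x
    obtain ⟨n, hn, z, hz, rfl⟩ := Submodule.mem_sup.1 (htop ▸ Submodule.mem_top : x ∈ _)
    obtain ⟨c, rfl⟩ := Submodule.mem_span_singleton.1 hz
    have hn0 : A n = 0 := hn
    have hφn : φ n = 0 := by rw [hφv, hn0, map_zero, mul_zero]
    simp [hn0, hφn, hφx₀]
  obtain ⟨y, hy, hgy⟩ := exists_norm_eq_one_dual_apply_eq_zero hY g
  have hyw : BirkhoffOrth y (A x₀) := by
    intro c
    rcases eq_or_ne c 0 with rfl | hc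
    · simp
    have h1 := hcore (φ.smulRight y) (φ.isCompactOperator_smulRight y) (by simp [hgy]) c hc
    have h2 : φ.smulRight y + c • A = φ.smulRight (y + c • A x₀) := by
      ext x
      have : A x = φ x • A x₀ := congrArg (fun B : X →L[ℝ] Y => B x) hAφ
      simp [this, smul_comm c]
    rw [h2, ContinuousLinearMap.norm_smulRight_apply, ContinuousLinearMap.norm_smulRight_apply] at h1
    exact (lt_of_mul_lt_mul_left h1 (norm_nonneg _)).le
  obtain ⟨f, hf, hf0⟩ := (Submodule.span ℝ {x₀}).exists_norm_one_dual_eq_zero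
    (Submodule.closed_of_finiteDimensional _) (span_singleton_ne_top_of_one_lt_rank hX x₀)
  have hfx₀ := hf0 x₀ (Submodule.mem_span_singleton_self x₀)
  obtain ⟨x₁, hx₁, hfx₁, hAx₁⟩ := hvanish f hf hfx₀
  have hφx₁ : φ x₁ = 0 := by rw [hφv, hAx₁, map_zero, mul_zero]
  -- `φ - f` equals `1` at both `x₀` and `-x₁`; norm at most `1` would force these to coincide, yet
  -- `f` separates them.
  have hφf : 1 < ‖φ - f‖ := by
    by_contra! hle
    have := eq_of_dual_apply_eq_one hle hx₀ (z := -x₁) (by rwa [norm_neg])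
      (by simp [hφx₀, hfx₀]) (by simp [hφx₁, hfx₁])
    rw [this, map_neg, hfx₁] at hfx₀
    norm_num at hfx₀
  obtain ⟨a, t, ht, hle⟩ := exists_norm_smulRight_add_le hφ hf.le hφf hy hyw
  have hlt := hcore ((φ - f).smulRight y + a • f.smulRight (A x₀))
    (((φ - f).isCompactOperator_smulRight y).add ((f.isCompactOperator_smulRight (A x₀)).smul a))
    (by simp [hfx₀, hgy]) t ht
  rw [← hAφ] at hle
  exact absurd hlt hle.not_gt

end

theorem theorem3p1 {X Y : Type*}
    [NormedAddCommGroup X] [NormedSpace ℝ X] [CompleteSpace X] [StrictConvexSpace ℝ X]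
    [NormedAddCommGroup Y] [NormedSpace ℝ Y] [CompleteSpace Y] [StrictConvexSpace ℝ Y]
    (hX : 1 < Module.rank ℝ X) (hY : 1 < Module.rank ℝ Y) (hrefl : IsReflexiveSpace X)
    (T : CompactOps X Y)
    (hT : IsSmoothPoint T ∨ IsSmoothPoint (T : X →L[ℝ] Y)) :
    ¬ IsRightSymmetric T ∧ ¬ IsRightSymmetric (T : X →L[ℝ] Y) := by
  have hK : ¬ IsRightSymmetric T :=
    (hT.elim id IsSmoothPoint.of_coe).not_isRightSymmetric_compactOps hX hY hrefl
  exact ⟨hK, fun h => hK h.of_coe⟩
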